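/- For a rational number $\alpha$ let $r_\alpha\ge 1$ be its denominator in lowest terms and put $\Delta_\alpha=\frac12\left(1-\frac1{r_\alpha^2}\right)$. For rational $\alpha,\beta$ with $3+\alpha-\beta\ne 0$ put $$\alpha.\beta=\frac{\alpha+\beta}2+\frac{\Delta_\beta-\Delta_\alpha}{3+\alpha-\beta}.$$ Define $\varepsilon:\mathbb Z[\tfrac12]\to\mathbb Q$ inductively by $\varepsilon(n)=n$ for $n\in\mathbb Z$ and $\varepsilon\left(\frac{2p+1}{2^{q}}\right)=\varepsilon\left(\frac p{2^{q-1}}\right).\,\varepsilon\left(\frac{p+1}{2^{q-1}}\right)$ for $p\in\mathbb Z$, $q\ge 1$, and let $\mathfrak E=\varepsilon(\mathbb Z[\tfrac12])$ (this is the set of slopes of exceptional bundles on $\mathbb P^2$). For $\alpha\in\mathfrak E$ let $$x_\alpha=\frac32-\sqrt{\frac94-\frac1{r_\alpha^2}},\qquad I_\alpha=(\alpha-x_\alpha,\alpha+x_\alpha)\subset\mathbb R,$$ and let $C=\mathbb R\setminus\bigcup_{\alpha\in\mathfrak E}I_\alpha$ be the generalized Cantor set. Let $P(x)=\frac12(x^2+3x+2)$,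 let $\delta(\mu)=P(-|\mu-\alpha|)-\Delta_\alpha$ for $\mu\in I_\alpha$, $\alpha\in\mathfrak E$, extended to $\mathbb R$ by $\delta(\xi)=\frac12$ for $\xi\in C$, and let $\gamma(\mu)=P(\mu)-\delta(\mu)$. **Theorem.** Every rational number lies in $I_\alpha$ for exactly one $\alpha\in\mathfrak E$ (so $\delta$ and $\gamma$ are well defined, and they take rational values at rational numbers), and $\gamma$ restricts to a bijection $\mathbb Q_{\ge 0}\to\mathbb Q_{\ge 0}$. Moreover, $\gamma$ is a continuous bijection $\mathbb R_{\ge 0}\to\mathbb R_{\ge 0}$, and for every $q\in\mathbb Q_{\ge 0}$ the number $\gamma^{-1}(q)$ does not lie in $C$. -/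

import Mathlib

namespace ExceptionalSlopes

noncomputable section

/-- The Hilbert polynomial `P(x) = (x² + 3x + 2)/2` of the structure sheaf of the plane,
over any field (used over `ℚ` and over `ℝ`). -/
def P {K : Type*} [Field K] (x : K) : K := (x ^ 2 + 3 * x + 2) / 2

/-- The discriminant `Δ_α = (1 - 1/r_α²)/2`, where `r_α = α.den` is the denominator of `α` in
lowest terms. -/
def disc (α : ℚ) : ℚ := (1 - 1 / (α.den : ℚ) ^ 2) / 2

/-- The operation `α.β = (α + β)/2 + (Δ_β - Δ_α)/(3 + α - β)`. -/
def dot (α β : ℚ) : ℚ := (α + β) / 2 + (disc β - disc α) / (3 + α - β)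

/-- `eps p q` is the value `ε(p/2^q)` of the map `ε` from the dyadic rationals to the exceptional
slopes: `ε(n) = n` for integers `n`, and
`ε((2p+1)/2^(q+1)) = ε(p/2^q).ε((p+1)/2^q)`. If the numerator is even the fraction is reduced. -/
def eps : ℤ → ℕ → ℚ
  | p, 0 => (p : ℚ)
  | p, q + 1 => if p % 2 = 0 then eps (p / 2) q else dot (eps (p / 2) q) (eps (p / 2 + 1) q)

theorem eps_zero (n : ℤ) : eps n 0 = n := rfl

theorem eps_even (p : ℤ) (q : ℕ) : eps (2 * p) (q + 1) = eps p q := by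
  simp [eps]

theorem eps_odd (p : ℤ) (q : ℕ) :
    eps (2 * p + 1) (q + 1) = dot (eps p q) (eps (p + 1) q) := by
  have h1 : (2 * p + 1) % 2 = 1 := by omega
  have h2 : (2 * p + 1) / 2 = p := by omega
  simp [eps, h1, h2]

theorem eps_shift (p : ℤ) (q k : ℕ) : eps (2 ^ k * p) (q + k) = eps p q := by
  induction k with
  | zero => simp
  | succ k ih =>
    rw [pow_succ', mul_assoc, ← add_assoc, eps_even, ih]

/-- `eps p q` depends only on the dyadic rational `p/2^q`. -/
theorem eps_congr {p p' : ℤ} {q q' : ℕ} (h : (p : ℚ) / 2 ^ q = (p' : ℚ) / 2 ^ q') :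
    eps p q = eps p' q' := by
  have h' : (2 : ℤ) ^ q' * p = 2 ^ q * p' := by
    rw [div_eq_div_iff (by positivity) (by positivity)] at h
    have : (2 : ℚ) ^ q' * p = 2 ^ q * p' := by linarith
    exact_mod_cast this
  rw [← eps_shift p q q', ← eps_shift p' q' q, h', add_comm]

/-- The set of exceptional slopes: the image of `ε`. -/
def exceptionalSlopes : Set ℚ := {α | ∃ (p : ℤ) (q : ℕ), eps p q = α}

/-- `x_α = 3/2 - √(9/4 - 1/r_α²)`. -/
def xRadius (α : ℚ) : ℝ := 3 / 2 - √(9 / 4 - 1 / (α.den : ℝ) ^ 2)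

/-- The open interval `I_α = (α - x_α, α + x_α)`. -/
def I (α : ℚ) : Set ℝ := Set.Ioo ((α : ℝ) - xRadius α) ((α : ℝ) + xRadius α)

/-- The generalized Cantor set, the complement of the union of the `I_α` over all exceptional
slopes `α`. -/
def cantorSet : Set ℝ := (⋃ α ∈ exceptionalSlopes, I α)ᶜ

/-- The exceptional slope associated to a real number that lies in some `I_α`. -/
def assocSlope (x : ℝ) (h : ∃ α : ℚ, α ∈ exceptionalSlopes ∧ x ∈ I α) : ℚ := h.choose

theorem assocSlope_mem (x : ℝ) (h : ∃ α : ℚ, α ∈ exceptionalSlopes ∧ x ∈ I α) :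
    assocSlope x h ∈ exceptionalSlopes ∧ x ∈ I (assocSlope x h) := h.choose_spec

open Classical in
/-- `δ : ℚ → ℚ`, `δ(μ) = P(-|μ - α|) - Δ_α` if `μ ∈ I_α` with `α` exceptional. (Every rational
number lies in exactly one `I_α`, so that the last branch is never taken.) -/
def delta (μ : ℚ) : ℚ :=
  if h : ∃ α : ℚ, α ∈ exceptionalSlopes ∧ (μ : ℝ) ∈ I α then
    P (-|μ - assocSlope μ h|) - disc (assocSlope μ h)
  else 1 / 2

open Classical in
/-- The extension of `δ` to the real line: the same formula on the intervals `I_α`, and the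
value `1/2` on the generalized Cantor set. -/
def deltaReal (x : ℝ) : ℝ :=
  if h : ∃ α : ℚ, α ∈ exceptionalSlopes ∧ x ∈ I α then
    P (-|x - (assocSlope x h : ℝ)|) - (disc (assocSlope x h) : ℝ)
  else 1 / 2

/-- `γ(μ) = P(μ) - δ(μ)` on the rational numbers. -/
def gamma (μ : ℚ) : ℚ := P μ - delta μ

/-- The extension of `γ` to the real numbers. -/
def gammaReal (x : ℝ) : ℝ := P x - deltaReal x

theorem deltaReal_ratCast (μ : ℚ) : deltaReal (μ : ℝ) = (delta μ : ℝ) := by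
  unfold deltaReal delta
  split_ifs with h
  · simp only [P]
    push_cast
    rfl
  · norm_num

theorem gammaReal_ratCast (μ : ℚ) : gammaReal (μ : ℝ) = (gamma μ : ℝ) := by
  unfold gammaReal gamma
  rw [deltaReal_ratCast]
  simp only [P]
  push_cast
  rfl

theorem deltaReal_of_mem_cantorSet {x : ℝ} (hx : x ∈ cantorSet) : deltaReal x = 1 / 2 := by
  unfold deltaReal
  rw [dif_neg]
  rintro ⟨α, hα, hxα⟩
  exact hx (Set.mem_biUnion hα hxα)

end

end ExceptionalSlopes

/-!
Consecutive values `α < β` of `ε` at a fixed level satisfy `P (α - β) = Δ_α + Δ_β`, and `x_α` is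
chosen so that `P (-x_α) = 1 / 2 + Δ_α`. Since `P (-(x_α + x_β)) = Δ_α + Δ_β + x_α x_β` is larger,
`x_α + x_β < β - α`, so the intervals `I_α` are disjoint. On each of them `δ` has slope at most
`3 / 2` in absolute value and is at least its value `1 / 2` at the ends, so `δ` is
`3 / 2`-Lipschitz, and `γ (y) - γ (x) ≥ (y² - x²) / 2` for `x ≤ y`: on the nonnegative half-line `γ`
is continuous, strictly increasing and unbounded.

A point `ξ` of the Cantor set lies between consecutive values of `ε` at every level. At level `q`
one of the two has rank `r ≥ 2 ^ q`, and its distance to `ξ` is less than `1 / r²`. Hence `ξ` has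
infinitely many rational approximations of quality `1 / r²` and is irrational. As the discriminants
`Δ_α = 1 / 2 - 1 / (2 r²)` of these approximations `α` tend to `1 / 2` at the same rate, and
`2 r (P (α) - Δ_α)` is an integer, the numbers `P (α) - Δ_α` approximate `γ (ξ) = P (ξ) - 1 / 2`
equally well up to a constant, so `γ (ξ)` is irrational too when `ξ ≥ 0`.

Off the Cantor set `γ` is piecewise affine with rational coefficients, so rational values there come
from rational points.
-/

namespace ExceptionalSlopes

open Filter

section HilbertPolynomial

variable {K : Type*} [Field K]

theorem P_sub_P (x y : K) : P x - P y = (x - y) * (x + y + 3) / 2 := by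
  unfold P
  ring

theorem P_add [CharZero K] (x y : K) : P (x + y) = P x + P y + x * y - 1 := by
  unfold P
  field_simp
  ring

theorem ratCast_P [CharZero K] (x : ℚ) : ((P x : ℚ) : K) = P (x : K) := by
  simp only [P]
  push_cast
  rfl

theorem strictMonoOn_P [LinearOrder K] [IsStrictOrderedRing K] :
    StrictMonoOn (P : K → K) (Set.Ici (-3 / 2)) := by
  intro x hx y hy hxy
  rw [Set.mem_Ici] at hx hy
  have : 0 < (y - x) * (y + x + 3) / 2 :=
    div_pos (mul_pos (by linarith) (by linarith)) two_pos
  linarith [P_sub_P y x]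

theorem P_neg_sub_P_neg_le [LinearOrder K] [IsStrictOrderedRing K] {x y : K} (hx : 0 ≤ x)
    (hy : 0 ≤ y) (hxy : x + y ≤ 3) : P (-x) - P (-y) ≤ 3 / 2 * |x - y| :=
  calc P (-x) - P (-y) = (y - x) * ((3 - (x + y)) / 2) := by rw [P_sub_P]; ring
    _ ≤ |x - y| * (3 / 2) := by
      rw [abs_sub_comm]
      exact mul_le_mul (le_abs_self _) (by linarith) (by linarith) (abs_nonneg _)
    _ = 3 / 2 * |x - y| := mul_comm _ _

end HilbertPolynomial

theorem den_cast_pos {K : Type*} [Field K] [LinearOrder K] [IsStrictOrderedRing K] (α : ℚ) :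
    0 < (α.den : K) :=
  Nat.cast_pos.2 α.den_pos

theorem disc_neg (α : ℚ) : disc (-α) = disc α := rfl

theorem dot_neg_neg (α β : ℚ) : dot (-β) (-α) = -dot α β := by
  rw [dot, dot, disc_neg, disc_neg, show 3 + -β - -α = 3 + α - β by ring]
  ring

/-- A pair of slopes of a strong exceptional pair of bundles. By Riemann–Roch, `orthogonal` says
that the Euler pairing `χ(β, α) = r_α r_β (P(α - β) - Δ_α - Δ_β)` vanishes. The remaining fields
record the arithmetic of the ranks that survives the passage from `(α, β)` to `(α, α.β)` and
`(α.β, β)`. -/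
structure IsExceptionalPair (α β : ℚ) : Prop where
  lt : α < β
  sub_le_one : β - α ≤ 1
  orthogonal : P (α - β) = disc α + disc β
  coprime_den : IsCoprime (α.den : ℤ) β.den
  left_den_dvd : (α.den : ℤ) ∣ α.num ^ 2 + 1
  right_den_dvd : (β.den : ℤ) ∣ β.num ^ 2 + 1

/-- The rank `3 r_α r_β - (r_α a_β - r_β a_α)` of the bundle of slope `α.β`, where `a / r` denotes
a slope in lowest terms. -/
def dotRank (α β : ℚ) : ℤ := 3 * α.den * β.den + α.num * β.den - β.num * α.den

theorem dotRank_cast (α β : ℚ) : (dotRank α β : ℚ) = α.den * β.den * (3 - (β - α)) := by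
  rw [dotRank]
  push_cast
  linear_combination (-β.den : ℚ) * α.mul_den_eq_num + (α.den : ℚ) * β.mul_den_eq_num

theorem dotRank_neg_neg (α β : ℚ) : dotRank (-β) (-α) = dotRank α β := by
  simp only [dotRank, Rat.neg_num, Rat.neg_den]
  ring

theorem num_eq_and_den_eq_of_dvd_sq_add_one {x : ℚ} {u t : ℤ} (ht : 0 < t) (h : x * t = u)
    (hdvd : t ∣ u ^ 2 + 1) : x.num = u ∧ (x.den : ℤ) = t := by
  obtain ⟨m, hm⟩ := hdvd
  have hcop : Nat.Coprime u.natAbs t.natAbs :=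
    Int.isCoprime_iff_gcd_eq_one.1 ⟨-u, m, by linear_combination -hm⟩
  rw [eq_div_of_mul_eq (Int.cast_ne_zero.2 ht.ne') h]
  exact ⟨Rat.num_div_eq_of_coprime ht hcop, Rat.den_div_eq_of_coprime ht hcop⟩

theorem isExceptionalPair_intCast (n : ℤ) : IsExceptionalPair n (n + 1 : ℤ) where
  lt := by simp
  sub_le_one := by simp
  orthogonal := by
    simp only [P, disc, Rat.den_intCast]
    push_cast
    ring
  coprime_den := by simpa using isCoprime_one_left
  left_den_dvd := by simp
  right_den_dvd := by simp

namespace IsExceptionalPair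

variable {α β : ℚ}

theorem neg (h : IsExceptionalPair α β) : IsExceptionalPair (-β) (-α) where
  lt := neg_lt_neg h.lt
  sub_le_one := by linarith [h.sub_le_one]
  orthogonal := by
    rw [disc_neg, disc_neg, add_comm (disc β), ← h.orthogonal]
    congr 1
    ring
  coprime_den := h.coprime_den.symm
  left_den_dvd := by simpa using h.right_den_dvd
  right_den_dvd := by simpa using h.left_den_dvd

theorem sub_mul_three_sub (h : IsExceptionalPair α β) :
    (β - α) * (3 - (β - α)) = 1 / (α.den : ℚ) ^ 2 + 1 / (β.den : ℚ) ^ 2 := by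
  have := h.orthogonal
  simp only [P, disc] at this
  linarith

theorem three_sub_pos (h : IsExceptionalPair α β) : 0 < 3 - (β - α) := by
  linarith [h.sub_le_one]

theorem dot_sub_left (h : IsExceptionalPair α β) :
    dot α β - α = 1 / ((α.den : ℚ) ^ 2 * (3 - (β - α))) := by
  have hd := h.three_sub_pos
  have hdot : dot α β - α =
      ((β - α) * (3 - (β - α)) + 2 * (disc β - disc α)) / (2 * (3 - (β - α))) := by
    rw [dot, show 3 + α - β = 3 - (β - α) by ring]
    field_simp
    ring
  have := den_cast_pos (K := ℚ) α
  rw [hdot, h.sub_mul_three_sub, disc, disc]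
  field_simp
  ring

theorem left_lt_dot (h : IsExceptionalPair α β) : α < dot α β := by
  have := h.three_sub_pos
  have := den_cast_pos (K := ℚ) α
  rw [← sub_pos, h.dot_sub_left]
  positivity

theorem dot_lt_right (h : IsExceptionalPair α β) : dot α β < β := by
  have := h.neg.left_lt_dot
  rw [dot_neg_neg] at this
  exact neg_lt_neg_iff.1 this

theorem dotRank_pos (h : IsExceptionalPair α β) : 0 < dotRank α β := by
  have := h.three_sub_pos
  have := den_cast_pos (K := ℚ) α
  have := den_cast_pos (K := ℚ) β
  rw [← Int.cast_pos (R := ℚ), dotRank_cast]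
  positivity

theorem isCoprime_left_den_dotRank (h : IsExceptionalPair α β) :
    IsCoprime (α.den : ℤ) (dotRank α β) := by
  have hred : IsCoprime (α.den : ℤ) α.num := α.isCoprime_num_den.symm
  rw [show dotRank α β = α.num * β.den + α.den * (3 * β.den - β.num) by rw [dotRank]; ring]
  exact (hred.mul_right h.coprime_den).add_mul_left_right _

theorem isCoprime_right_den_dotRank (h : IsExceptionalPair α β) :
    IsCoprime (β.den : ℤ) (dotRank α β) := by
  rw [← dotRank_neg_neg]
  exact h.neg.isCoprime_left_den_dotRank

theorem left_den_mul_dot (h : IsExceptionalPair α β) :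
    α.den * (dot α β * dotRank α β) = α.num * dotRank α β + β.den := by
  have := den_cast_pos (K := ℚ) α
  have := h.three_sub_pos
  have hsub : α.den * ((dot α β - α) * dotRank α β) = β.den := by
    rw [h.dot_sub_left, dotRank_cast]
    field_simp
  linear_combination hsub + (dotRank α β : ℚ) * α.mul_den_eq_num

theorem right_den_mul_dot (h : IsExceptionalPair α β) :
    β.den * (dot α β * dotRank α β) = β.num * dotRank α β - α.den := by
  have := h.neg.left_den_mul_dot
  rw [dotRank_neg_neg, dot_neg_neg, Rat.neg_den, Rat.neg_den,
    Rat.neg_num] at this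
  push_cast at this
  linear_combination -this

theorem exists_dot_mul_dotRank_eq_intCast (h : IsExceptionalPair α β) :
    ∃ u : ℤ, dot α β * dotRank α β = u := by
  -- `r_α ∣ a_α² + 1`, and the rank of `α.β` is congruent to `a_α r_β` modulo `r_α`
  have hdvd : (α.den : ℤ) ∣ α.num * dotRank α β + β.den := by
    rw [show α.num * dotRank α β + β.den =
      (α.num ^ 2 + 1) * β.den + α.den * (α.num * (3 * β.den - β.num)) by rw [dotRank]; ring]
    exact (h.left_den_dvd.mul_right _).add (dvd_mul_right _ _)
  obtain ⟨u, hu⟩ := hdvd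
  refine ⟨u, mul_left_cancel₀ (den_cast_pos α).ne' ?_⟩
  rw [h.left_den_mul_dot]
  exact_mod_cast hu

theorem dotRank_dvd_sq_add_one (h : IsExceptionalPair α β) {u : ℤ}
    (hu : dot α β * dotRank α β = u) : dotRank α β ∣ u ^ 2 + 1 := by
  have hleft : (α.den : ℤ) * u = α.num * dotRank α β + β.den := by
    exact_mod_cast hu ▸ h.left_den_mul_dot
  have hright : (β.den : ℤ) * u = β.num * dotRank α β - α.den := by
    exact_mod_cast hu ▸ h.right_den_mul_dot
  have hcop : IsCoprime (dotRank α β) (α.den * β.den) :=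
    (h.isCoprime_left_den_dotRank.mul_left h.isCoprime_right_den_dotRank).symm
  refine hcop.dvd_of_dvd_mul_left
    ⟨α.num * β.num * dotRank α β + β.num * β.den - α.num * α.den, ?_⟩
  linear_combination (β.den * u : ℤ) * hleft + (α.num * dotRank α β + β.den) * hright

theorem den_dot_and_dvd (h : IsExceptionalPair α β) :
    ((dot α β).den : ℤ) = dotRank α β ∧
      ((dot α β).den : ℤ) ∣ (dot α β).num ^ 2 + 1 := by
  obtain ⟨u, hu⟩ := h.exists_dot_mul_dotRank_eq_intCast
  have hdvd := h.dotRank_dvd_sq_add_one hu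
  obtain ⟨hnum, hden⟩ := num_eq_and_den_eq_of_dvd_sq_add_one h.dotRank_pos hu hdvd
  exact ⟨hden, by rwa [hnum, hden]⟩

theorem den_dot (h : IsExceptionalPair α β) :
    ((dot α β).den : ℚ) = α.den * β.den * (3 - (β - α)) := by
  rw [← dotRank_cast]
  exact_mod_cast h.den_dot_and_dvd.1

theorem two_mul_den_mul_den_le_den_dot (h : IsExceptionalPair α β) :
    2 * (α.den * β.den) ≤ (dot α β).den := by
  have : (2 * (α.den * β.den) : ℚ) ≤ (dot α β).den := by
    rw [h.den_dot, mul_comm]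
    gcongr
    linarith [h.sub_le_one]
  exact_mod_cast this

theorem orthogonal_dot (h : IsExceptionalPair α β) :
    P (α - dot α β) = disc α + disc (dot α β) := by
  have hd := h.three_sub_pos
  have := den_cast_pos (K := ℚ) α
  have := den_cast_pos (K := ℚ) β
  have hsq : 1 / (β.den : ℚ) ^ 2 = (β - α) * (3 - (β - α)) - 1 / (α.den : ℚ) ^ 2 := by
    rw [h.sub_mul_three_sub, add_sub_cancel_left]
  have hdisc : disc (dot α β) =
      (1 - 1 / (β.den : ℚ) ^ 2 / (α.den * (3 - (β - α))) ^ 2) / 2 := by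
    rw [disc, h.den_dot]
    field_simp
  rw [hdisc, hsq, disc, ← neg_sub, h.dot_sub_left, P]
  field_simp
  ring

theorem left_dot (h : IsExceptionalPair α β) : IsExceptionalPair α (dot α β) where
  lt := h.left_lt_dot
  sub_le_one := by linarith [h.dot_lt_right, h.sub_le_one]
  orthogonal := h.orthogonal_dot
  coprime_den := h.den_dot_and_dvd.1 ▸ h.isCoprime_left_den_dotRank
  left_den_dvd := h.left_den_dvd
  right_den_dvd := h.den_dot_and_dvd.2

theorem dot_right (h : IsExceptionalPair α β) : IsExceptionalPair (dot α β) β := by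
  have := h.neg.left_dot.neg
  rwa [dot_neg_neg, neg_neg, neg_neg] at this

end IsExceptionalPair

theorem isExceptionalPair_eps (p : ℤ) (q : ℕ) :
    IsExceptionalPair (eps p q) (eps (p + 1) q) := by
  induction q generalizing p with
  | zero => exact isExceptionalPair_intCast p
  | succ q ih =>
    obtain ⟨m, rfl | rfl⟩ := Int.even_or_odd' p
    · rw [eps_even, eps_odd]
      exact (ih m).left_dot
    · rw [eps_odd, show 2 * m + 1 + 1 = 2 * (m + 1) by ring, eps_even]
      exact (ih m).dot_right

section Intervals

theorem ratCast_disc (α : ℚ) : (disc α : ℝ) = (1 - 1 / (α.den : ℝ) ^ 2) / 2 := by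
  rw [disc]
  push_cast
  rfl

theorem one_div_den_sq_pos (α : ℚ) : 0 < 1 / (α.den : ℝ) ^ 2 :=
  one_div_pos.2 (pow_pos (den_cast_pos α) 2)

theorem one_div_den_sq_le_one (α : ℚ) : 1 / (α.den : ℝ) ^ 2 ≤ 1 :=
  div_le_one_of_le₀ (one_le_pow₀ (Nat.one_le_cast.2 α.den_pos)) (sq_nonneg _)

theorem disc_lt_half (α : ℚ) : (disc α : ℝ) < 1 / 2 := by
  linarith [ratCast_disc α, one_div_den_sq_pos α]

theorem xRadius_pos (α : ℚ) : 0 < xRadius α := by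
  have : √(9 / 4 - 1 / (α.den : ℝ) ^ 2) < 3 / 2 :=
    (Real.sqrt_lt' (by norm_num)).2 (by linarith [one_div_den_sq_pos α])
  rw [xRadius]
  linarith

theorem xRadius_lt_half (α : ℚ) : xRadius α < 1 / 2 := by
  have : 1 < √(9 / 4 - 1 / (α.den : ℝ) ^ 2) :=
    (Real.lt_sqrt zero_le_one).2 (by linarith [one_div_den_sq_le_one α])
  rw [xRadius]
  linarith

theorem P_neg_xRadius (α : ℚ) : P (-xRadius α) = 1 / 2 + disc α := by
  have := Real.sq_sqrt (show 0 ≤ 9 / 4 - 1 / (α.den : ℝ) ^ 2 by linarith [one_div_den_sq_le_one α])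
  rw [P, ratCast_disc, xRadius]
  linear_combination this / 2

theorem one_div_den_sq_lt_three_mul_xRadius (α : ℚ) : 1 / (α.den : ℝ) ^ 2 < 3 * xRadius α := by
  have h := P_neg_xRadius α
  rw [P, ratCast_disc] at h
  linarith [pow_pos (xRadius_pos α) 2]

theorem mem_I_iff {α : ℚ} {x : ℝ} : x ∈ I α ↔ |x - α| < xRadius α := by
  rw [I, ← Real.ball_eq_Ioo, Metric.mem_ball, Real.dist_eq]

theorem self_mem_I (α : ℚ) : (α : ℝ) ∈ I α := by
  rw [mem_I_iff, sub_self, abs_zero]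
  exact xRadius_pos α

theorem IsExceptionalPair.ratCast_orthogonal {α β : ℚ} (h : IsExceptionalPair α β) :
    P ((α : ℝ) - β) = disc α + disc β := by
  exact_mod_cast (ratCast_P (K := ℝ) (α - β)).symm.trans (congrArg Rat.cast h.orthogonal)

/-- Both sides lie in the range where `P` is increasing, and
`P (-(x_α + x_β)) = Δ_α + Δ_β + x_α x_β` exceeds `P (α - β) = Δ_α + Δ_β`. -/
theorem IsExceptionalPair.add_xRadius_lt_sub_xRadius {α β : ℚ} (h : IsExceptionalPair α β) :
    (α : ℝ) + xRadius α < β - xRadius β := by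
  have hle : (β : ℝ) - α ≤ 1 := by exact_mod_cast h.sub_le_one
  have hP : P ((α : ℝ) - β) < P (-xRadius α + -xRadius β) := by
    rw [P_add, P_neg_xRadius, P_neg_xRadius, h.ratCast_orthogonal]
    linarith [mul_pos (xRadius_pos α) (xRadius_pos β)]
  have := (strictMonoOn_P.lt_iff_lt (Set.mem_Ici.2 (by linarith))
    (Set.mem_Ici.2 (by linarith [xRadius_lt_half α, xRadius_lt_half β]))).1 hP
  linarith

theorem strictMono_eps_sub_xRadius (q : ℕ) :
    StrictMono fun p : ℤ => (eps p q : ℝ) - xRadius (eps p q) :=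
  strictMono_int_of_lt_succ fun p => by
    linarith [(isExceptionalPair_eps p q).add_xRadius_lt_sub_xRadius, xRadius_pos (eps p q)]

theorem strictMono_eps (q : ℕ) : StrictMono fun p : ℤ => eps p q :=
  strictMono_int_of_lt_succ fun p => (isExceptionalPair_eps p q).lt

theorem exists_common_level {α β : ℚ} (hα : α ∈ exceptionalSlopes)
    (hβ : β ∈ exceptionalSlopes) : ∃ i j q, eps i q = α ∧ eps j q = β := by
  obtain ⟨i, q, rfl⟩ := hα
  obtain ⟨j, q', rfl⟩ := hβ
  exact ⟨2 ^ q' * i, 2 ^ q * j, q + q', eps_shift i q q', add_comm q q' ▸ eps_shift j q' q⟩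

theorem add_xRadius_lt_sub_xRadius {α β : ℚ} (hα : α ∈ exceptionalSlopes)
    (hβ : β ∈ exceptionalSlopes) (h : α < β) : (α : ℝ) + xRadius α < β - xRadius β := by
  obtain ⟨i, j, q, rfl, rfl⟩ := exists_common_level hα hβ
  have hij : i + 1 ≤ j := (strictMono_eps q).lt_iff_lt.1 h
  exact (isExceptionalPair_eps i q).add_xRadius_lt_sub_xRadius.trans_le
    ((strictMono_eps_sub_xRadius q).monotone hij)

theorem pairwiseDisjoint_I : exceptionalSlopes.PairwiseDisjoint I := by
  intro α hα β hβ hne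
  wlog h : α < β generalizing α β
  · exact (this hβ hα hne.symm (hne.lt_or_gt.resolve_left h)).symm
  · exact Set.disjoint_left.2 fun x hxα hxβ =>
      (hxα.2.trans (add_xRadius_lt_sub_xRadius hα hβ h)).not_gt hxβ.1

theorem intCast_mem_exceptionalSlopes (n : ℤ) : (n : ℚ) ∈ exceptionalSlopes :=
  ⟨n, 0, eps_zero n⟩

theorem zero_mem_exceptionalSlopes : (0 : ℚ) ∈ exceptionalSlopes := by
  exact_mod_cast intCast_mem_exceptionalSlopes 0

theorem add_xRadius_lt_neg_xRadius_zero {α : ℚ} (hα : α ∈ exceptionalSlopes) (h : α < 0) :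
    (α : ℝ) + xRadius α < -xRadius 0 := by
  simpa using add_xRadius_lt_sub_xRadius hα zero_mem_exceptionalSlopes h

theorem mem_cantorSet_iff {x : ℝ} :
    x ∈ cantorSet ↔ ∀ α ∈ exceptionalSlopes, xRadius α ≤ |x - α| := by
  simp [cantorSet, mem_I_iff]

theorem notMem_cantorSet_iff {x : ℝ} : x ∉ cantorSet ↔ ∃ α ∈ exceptionalSlopes, x ∈ I α := by
  simp [cantorSet]

end Intervals

section Continuity

variable {α : ℚ} {x y : ℝ}

theorem deltaReal_of_mem_I (hα : α ∈ exceptionalSlopes) (hx : x ∈ I α) :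
    deltaReal x = P (-|x - α|) - disc α := by
  have h : ∃ α : ℚ, α ∈ exceptionalSlopes ∧ x ∈ I α := ⟨α, hα, hx⟩
  have hassoc : assocSlope x h = α :=
    pairwiseDisjoint_I.elim_set (assocSlope_mem x h).1 hα x (assocSlope_mem x h).2 hx
  rw [deltaReal, dif_pos h, hassoc]

theorem half_le_deltaReal (x : ℝ) : 1 / 2 ≤ deltaReal x := by
  by_cases hx : x ∈ cantorSet
  · exact (deltaReal_of_mem_cantorSet hx).ge
  · obtain ⟨α, hα, hxα⟩ := notMem_cantorSet_iff.1 hx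
    have hlt := mem_I_iff.1 hxα
    have hP : P (-xRadius α) < P (-|x - α|) :=
      strictMonoOn_P (Set.mem_Ici.2 (by linarith [xRadius_lt_half α]))
        (Set.mem_Ici.2 (by linarith [xRadius_lt_half α])) (neg_lt_neg hlt)
    rw [deltaReal_of_mem_I hα hxα]
    linarith [P_neg_xRadius α]

theorem P_neg_min_sub_disc_le_deltaReal (hα : α ∈ exceptionalSlopes) (y : ℝ) :
    P (-min |y - α| (xRadius α)) - disc α ≤ deltaReal y := by
  by_cases hy : y ∈ I α
  · rw [min_eq_left (mem_I_iff.1 hy).le, deltaReal_of_mem_I hα hy]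
  · rw [min_eq_right (not_lt.1 (mt mem_I_iff.2 hy)), P_neg_xRadius]
    linarith [half_le_deltaReal y]

theorem deltaReal_sub_deltaReal_le (x y : ℝ) : deltaReal x - deltaReal y ≤ 3 / 2 * |x - y| := by
  by_cases hx : x ∈ cantorSet
  · rw [deltaReal_of_mem_cantorSet hx]
    linarith [half_le_deltaReal y, abs_nonneg (x - y)]
  obtain ⟨α, hα, hxα⟩ := notMem_cantorSet_iff.1 hx
  have hlt := mem_I_iff.1 hxα
  have hmin := min_le_right |y - α| (xRadius α)
  calc deltaReal x - deltaReal y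
      ≤ (P (-|x - α|) - disc α) - (P (-min |y - α| (xRadius α)) - disc α) := by
        rw [deltaReal_of_mem_I hα hxα]
        exact sub_le_sub_left (P_neg_min_sub_disc_le_deltaReal hα y) _
    _ = P (-min |x - α| (xRadius α)) - P (-min |y - α| (xRadius α)) := by
        rw [sub_sub_sub_cancel_right, min_eq_left hlt.le]
    _ ≤ 3 / 2 * |min |x - α| (xRadius α) - min |y - α| (xRadius α)| :=
        P_neg_sub_P_neg_le (le_min (abs_nonneg _) (xRadius_pos α).le)
          (le_min (abs_nonneg _) (xRadius_pos α).le)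
          (by linarith [min_le_right |x - α| (xRadius α), xRadius_lt_half α])
    _ ≤ 3 / 2 * |x - y| := by
        refine mul_le_mul_of_nonneg_left ?_ (by norm_num)
        have h := abs_abs_sub_abs_le (x - α) (y - α)
        rw [sub_sub_sub_cancel_right] at h
        exact (abs_inf_sub_inf_le_abs |x - α| |y - α| (xRadius α)).trans h

theorem lipschitzWith_deltaReal : LipschitzWith (3 / 2) deltaReal :=
  LipschitzWith.of_le_add_mul _ fun x y => by
    have := deltaReal_sub_deltaReal_le x y
    rw [Real.dist_eq]
    push_cast
    linarith

theorem continuous_gammaReal : Continuous gammaReal := by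
  have := lipschitzWith_deltaReal.continuous
  unfold gammaReal P
  fun_prop

theorem sq_sub_sq_div_two_le_gammaReal_sub (hxy : x ≤ y) :
    (y ^ 2 - x ^ 2) / 2 ≤ gammaReal y - gammaReal x := by
  have := deltaReal_sub_deltaReal_le y x
  rw [abs_of_nonneg (sub_nonneg.2 hxy)] at this
  unfold gammaReal P
  linarith

theorem strictMonoOn_gammaReal : StrictMonoOn gammaReal (Set.Ici 0) := by
  intro x hx y _ hxy
  linarith [sq_sub_sq_div_two_le_gammaReal_sub hxy.le, pow_lt_pow_left₀ hxy hx two_ne_zero]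

theorem tendsto_gammaReal_atTop : Tendsto gammaReal atTop atTop := by
  have hsq : Tendsto (fun x : ℝ => gammaReal 0 + x ^ 2 / 2) atTop atTop :=
    tendsto_atTop_add_const_left _ _
      ((tendsto_pow_atTop two_ne_zero).atTop_div_const two_pos)
  refine tendsto_atTop_mono' _ ?_ hsq
  filter_upwards [eventually_ge_atTop 0] with x hx
  linarith [sq_sub_sq_div_two_le_gammaReal_sub hx]

theorem gammaReal_of_mem_I_of_le (hα : α ∈ exceptionalSlopes) (hx : x ∈ I α) (h : α ≤ x) :
    gammaReal x = (α + 3) * (x - α / 2) + disc α := by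
  rw [gammaReal, deltaReal_of_mem_I hα hx, abs_of_nonneg (sub_nonneg.2 h), P, P]
  ring

theorem gammaReal_of_mem_I_of_ge (hα : α ∈ exceptionalSlopes) (hx : x ∈ I α) (h : x ≤ α) :
    gammaReal x = α * (x + (3 - α) / 2) + disc α := by
  rw [gammaReal, deltaReal_of_mem_I hα hx, abs_of_nonpos (sub_nonpos.2 h), P, P]
  ring

theorem gammaReal_zero : gammaReal 0 = 0 := by
  have h := gammaReal_of_mem_I_of_le zero_mem_exceptionalSlopes (self_mem_I 0) le_rfl
  simpa [disc] using h

theorem bijOn_gammaReal : Set.BijOn gammaReal (Set.Ici 0) (Set.Ici 0) := by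
  have himage := continuous_gammaReal.continuousOn.image_Ici_of_monotoneOn
    strictMonoOn_gammaReal.monotoneOn tendsto_gammaReal_atTop
  rw [gammaReal_zero] at himage
  exact ⟨Set.image_subset_iff.1 himage.le, strictMonoOn_gammaReal.injOn, himage.ge⟩

end Continuity

section Approximation

variable {α β : ℚ} {ξ : ℝ}

theorem irrational_of_forall_exists_abs_sub_div_lt {x C : ℝ}
    (h : ∀ N : ℕ, ∃ n ≥ N, ∃ m : ℤ, x ≠ m / n ∧ |x - m / n| < C / (n : ℝ) ^ 2) :
    Irrational x := by
  refine LiouvilleWith.irrational (p := 2) ⟨C, frequently_atTop.2 fun N => ?_⟩ one_lt_two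
  simpa only [Real.rpow_two] using h N

/-- `P (-x_β) - P (α - β) = 1 / (2 r_α²)`, and the slope of this secant of `P` exceeds `1 / 2`. -/
theorem IsExceptionalPair.sub_xRadius_sub_lt (h : IsExceptionalPair α β) :
    (β : ℝ) - xRadius β - α < 1 / (α.den : ℝ) ^ 2 := by
  have hgap := h.add_xRadius_lt_sub_xRadius
  have hα := xRadius_pos α
  have hle : (β : ℝ) - α ≤ 1 := by exact_mod_cast h.sub_le_one
  have hP := P_sub_P (-xRadius β) ((α : ℝ) - β)
  rw [P_neg_xRadius, h.ratCast_orthogonal, ratCast_disc α] at hP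
  calc (β : ℝ) - xRadius β - α
      < (β - xRadius β - α) * (3 - xRadius β - (β - α)) :=
        lt_mul_of_one_lt_right (by linarith) (by linarith)
    _ = 1 / (α.den : ℝ) ^ 2 := by linear_combination -2 * hP

theorem xRadius_neg (α : ℚ) : xRadius (-α) = xRadius α := rfl

theorem IsExceptionalPair.sub_add_xRadius_lt (h : IsExceptionalPair α β) :
    (β : ℝ) - (α + xRadius α) < 1 / (β.den : ℝ) ^ 2 := by
  have := h.neg.sub_xRadius_sub_lt
  rw [xRadius_neg, Rat.neg_den] at this
  push_cast at this
  linarith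

theorem ne_ratCast_of_mem_cantorSet (hξ : ξ ∈ cantorSet) (hα : α ∈ exceptionalSlopes) :
    ξ ≠ α := by
  rintro rfl
  exact hξ (Set.mem_biUnion hα (self_mem_I α))

theorem exists_eps_lt_lt_eps (hξ : ξ ∈ cantorSet) (q : ℕ) :
    ∃ p : ℤ, (eps p q : ℝ) < ξ ∧ ξ < eps (p + 1) q ∧
      2 ^ q ≤ max (eps p q).den (eps (p + 1) q).den := by
  induction q with
  | zero =>
    refine ⟨⌊ξ⌋, lt_of_le_of_ne ?_ (ne_ratCast_of_mem_cantorSet hξ ⟨_, _, rfl⟩).symm, ?_, ?_⟩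
    · simpa [eps_zero] using Int.floor_le ξ
    · simp [eps_zero]
    · simp [eps_zero]
  | succ q ih =>
    obtain ⟨p, hlt, hgt, hmax⟩ := ih
    have hden : 2 ^ (q + 1) ≤ (eps (2 * p + 1) (q + 1)).den := by
      rw [eps_odd]
      refine le_trans ?_ (isExceptionalPair_eps p q).two_mul_den_mul_den_le_den_dot
      rw [pow_succ']
      exact Nat.mul_le_mul_left 2 (hmax.trans (max_le (Nat.le_mul_of_pos_right _ (Rat.den_pos _))
        (Nat.le_mul_of_pos_left _ (Rat.den_pos _))))
    rcases lt_or_gt_of_ne (ne_ratCast_of_mem_cantorSet hξ ⟨2 * p + 1, q + 1, rfl⟩) with h | h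
    · exact ⟨2 * p, by rwa [eps_even], h, le_max_of_le_right hden⟩
    · exact ⟨2 * p + 1, h, by rwa [add_assoc, one_add_one_eq_two, ← mul_add_one, eps_even],
        le_max_of_le_left hden⟩

theorem exists_abs_sub_lt_one_div_den_sq (hξ : ξ ∈ cantorSet) (n : ℕ) :
    ∃ α ∈ exceptionalSlopes, n ≤ α.den ∧ |ξ - α| < 1 / (α.den : ℝ) ^ 2 := by
  obtain ⟨p, hlt, hgt, hmax⟩ := exists_eps_lt_lt_eps hξ n
  have hpair := isExceptionalPair_eps p n
  rcases le_max_iff.1 (Nat.lt_two_pow_self.le.trans hmax) with hn | hn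
  · refine ⟨eps p n, ⟨p, n, rfl⟩, hn, ?_⟩
    have hout := mem_cantorSet_iff.1 hξ (eps (p + 1) n) ⟨p + 1, n, rfl⟩
    rw [abs_of_neg (sub_neg.2 hgt)] at hout
    rw [abs_of_pos (sub_pos.2 hlt)]
    linarith [hpair.sub_xRadius_sub_lt]
  · refine ⟨eps (p + 1) n, ⟨p + 1, n, rfl⟩, hn, ?_⟩
    have hout := mem_cantorSet_iff.1 hξ (eps p n) ⟨p, n, rfl⟩
    rw [abs_of_pos (sub_pos.2 hlt)] at hout
    rw [abs_of_neg (sub_neg.2 hgt)]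
    linarith [hpair.sub_add_xRadius_lt]

theorem irrational_of_mem_cantorSet (hξ : ξ ∈ cantorSet) : Irrational ξ := by
  refine irrational_of_forall_exists_abs_sub_div_lt (C := 1) fun n => ?_
  obtain ⟨α, hα, hn, hlt⟩ := exists_abs_sub_lt_one_div_den_sq hξ n
  have hne := ne_ratCast_of_mem_cantorSet hξ hα
  rw [Rat.cast_def] at hne hlt
  exact ⟨α.den, hn, α.num, hne, hlt⟩

theorem exists_mem_I_ratCast (μ : ℚ) : ∃ α ∈ exceptionalSlopes, (μ : ℝ) ∈ I α :=
  notMem_cantorSet_iff.1 fun h => irrational_of_mem_cantorSet h ⟨μ, rfl⟩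

theorem nonneg_of_abs_sub_lt_one_div_den_sq (hξ : ξ ∈ cantorSet) (hξ₀ : 0 ≤ ξ)
    (hα : α ∈ exceptionalSlopes) (h : |ξ - α| < 1 / (α.den : ℝ) ^ 2) : (0 : ℝ) ≤ α := by
  by_contra! hneg
  have hgap := add_xRadius_lt_neg_xRadius_zero hα (by exact_mod_cast hneg)
  have hout := mem_cantorSet_iff.1 hξ 0 zero_mem_exceptionalSlopes
  rw [Rat.cast_zero, sub_zero, abs_of_nonneg hξ₀] at hout
  have hzero : 1 < 3 * xRadius 0 := by simpa using one_div_den_sq_lt_three_mul_xRadius 0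
  linarith [le_abs_self (ξ - α), one_div_den_sq_lt_three_mul_xRadius α, one_div_den_sq_le_one α]

/-- By Riemann–Roch `r_α (P(α) - Δ_α)` is an Euler characteristic, hence even an integer; that it
is a half-integer already follows from `r_α ∣ a_α² + 1`. -/
theorem exists_two_mul_den_mul_eq_intCast (hα : α ∈ exceptionalSlopes) :
    ∃ k : ℤ, 2 * α.den * (P α - disc α) = k := by
  obtain ⟨p, q, rfl⟩ := hα
  obtain ⟨m, hm⟩ := (isExceptionalPair_eps p q).left_den_dvd
  set α := eps p q
  refine ⟨m + 3 * α.num + α.den, ?_⟩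
  have := den_cast_pos (K := ℚ) α
  have hm' : (α.num : ℚ) ^ 2 + 1 = α.den * m := by exact_mod_cast hm
  have hnum := α.mul_den_eq_num
  rw [P, disc]
  field_simp
  push_cast
  linear_combination hm' + (α * α.den + α.num + 3 * α.den) * hnum

theorem P_sub_half_ne_P_sub_disc (hξ₀ : 0 ≤ ξ) (hα : (0 : ℝ) ≤ α) (h : xRadius α ≤ |ξ - α|) :
    P ξ - 1 / 2 ≠ P (α : ℝ) - disc α := by
  have hx := xRadius_pos α
  have hmono {y z : ℝ} (hy : 0 ≤ y) (hyz : y ≤ z) : P y ≤ P z :=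
    strictMonoOn_P.monotoneOn (Set.mem_Ici.2 (by linarith)) (Set.mem_Ici.2 (by linarith)) hyz
  rcases le_abs.1 h with h | h
  · have hξ := hmono (by positivity) (show (α : ℝ) + xRadius α ≤ ξ by linarith)
    rw [P_add] at hξ
    have hP : P (xRadius α) = 1 / 2 + disc α + 3 * xRadius α := by
      rw [← P_neg_xRadius, P, P]
      ring
    apply ne_of_gt
    linarith [ratCast_disc α, one_div_den_sq_lt_three_mul_xRadius α, mul_nonneg hα hx.le]
  · have := hmono hξ₀ (show ξ ≤ α by linarith)
    apply ne_of_lt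
    linarith [disc_lt_half α]

theorem abs_P_sub_half_sub_lt (hξ₀ : 0 ≤ ξ) (hα : (0 : ℝ) ≤ α) (h : |ξ - α| < 1 / (α.den : ℝ) ^ 2) :
    |P ξ - 1 / 2 - (P (α : ℝ) - disc α)| < (4 * ξ + 10) / (2 * (α.den : ℝ)) ^ 2 := by
  have hα' : (α : ℝ) < ξ + 1 := by
    linarith [neg_abs_le (ξ - α), one_div_den_sq_le_one α]
  have hr := one_div_den_sq_pos α
  calc |P ξ - 1 / 2 - (P (α : ℝ) - disc α)|
      = |(ξ - α) * ((ξ + α + 3) / 2) - 1 / (α.den : ℝ) ^ 2 / 2| := by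
        rw [sub_sub_sub_comm, P_sub_P, ratCast_disc]
        congr 1
        ring
    _ ≤ |ξ - α| * ((ξ + α + 3) / 2) + 1 / (α.den : ℝ) ^ 2 / 2 := by
        refine (abs_sub _ _).trans_eq ?_
        rw [abs_mul, abs_of_pos (half_pos hr), abs_of_nonneg (by linarith : 0 ≤ (ξ + α + 3) / 2)]
    _ < 1 / (α.den : ℝ) ^ 2 * ((ξ + (ξ + 1) + 3) / 2) + 1 / (α.den : ℝ) ^ 2 / 2 := by
        gcongr
    _ = (4 * ξ + 10) / (2 * (α.den : ℝ)) ^ 2 := by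
        field_simp
        ring

theorem irrational_gammaReal_of_mem_cantorSet (hξ : ξ ∈ cantorSet) (hξ₀ : 0 ≤ ξ) :
    Irrational (gammaReal ξ) := by
  rw [gammaReal, deltaReal_of_mem_cantorSet hξ]
  refine irrational_of_forall_exists_abs_sub_div_lt (C := 4 * ξ + 10) fun n => ?_
  obtain ⟨α, hα, hn, hlt⟩ := exists_abs_sub_lt_one_div_den_sq hξ n
  have hα₀ := nonneg_of_abs_sub_lt_one_div_den_sq hξ hξ₀ hα hlt
  obtain ⟨k, hk⟩ := exists_two_mul_den_mul_eq_intCast hα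
  have hfrac : (k : ℝ) / (2 * α.den : ℕ) = P (α : ℝ) - disc α := by
    have := den_cast_pos (K := ℚ) α
    rw [← ratCast_P, ← Rat.cast_sub, eq_div_of_mul_eq (by positivity) ((mul_comm _ _).trans hk)]
    push_cast
    rfl
  refine ⟨2 * α.den, by lia, k, ?_, ?_⟩
  · rw [hfrac]
    exact P_sub_half_ne_P_sub_disc hξ₀ hα₀ (mem_cantorSet_iff.1 hξ α hα)
  · rw [hfrac]
    exact_mod_cast abs_P_sub_half_sub_lt hξ₀ hα₀ hlt

end Approximation

section RationalValues

variable {α : ℚ} {x : ℝ}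

theorem nonneg_of_mem_I (hα : α ∈ exceptionalSlopes) (hx₀ : 0 ≤ x) (hx : x ∈ I α) : 0 ≤ α := by
  by_contra! hneg
  linarith [add_xRadius_lt_neg_xRadius_zero hα hneg, xRadius_pos 0, hx.2]

theorem exists_ratCast_eq_of_gammaReal_eq_ratCast {q : ℚ} (hx₀ : 0 ≤ x)
    (hx : gammaReal x = q) : ∃ μ : ℚ, (μ : ℝ) = x := by
  have hnot : x ∉ cantorSet := fun h =>
    irrational_gammaReal_of_mem_cantorSet h hx₀ ⟨q, hx.symm⟩
  obtain ⟨α, hα, hxα⟩ := notMem_cantorSet_iff.1 hnot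
  have hα₀ : (0 : ℝ) ≤ α := by exact_mod_cast nonneg_of_mem_I hα hx₀ hxα
  rcases le_or_gt (α : ℝ) x with h | h
  · rw [gammaReal_of_mem_I_of_le hα hxα h] at hx
    refine ⟨(q - disc α) / (α + 3) + α / 2, ?_⟩
    push_cast
    field_simp
    linear_combination -2 * hx
  · have hαpos : (0 : ℝ) < α := hx₀.trans_lt h
    rw [gammaReal_of_mem_I_of_ge hα hxα h.le] at hx
    refine ⟨(q - disc α) / α - (3 - α) / 2, ?_⟩
    push_cast
    field_simp
    linear_combination -2 * hx

theorem bijOn_gamma : Set.BijOn gamma (Set.Ici 0) (Set.Ici 0) := by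
  have hbij := bijOn_gammaReal
  refine ⟨fun μ hμ => ?_, fun μ hμ ν hν h => ?_, fun q hq => ?_⟩
  · have := hbij.mapsTo (Set.mem_Ici.2 (Rat.cast_nonneg.2 hμ))
    rw [Set.mem_Ici, gammaReal_ratCast] at this
    exact Rat.cast_nonneg.1 this
  · refine Rat.cast_injective (hbij.injOn (Set.mem_Ici.2 (Rat.cast_nonneg.2 hμ))
      (Set.mem_Ici.2 (Rat.cast_nonneg.2 hν)) ?_)
    rw [gammaReal_ratCast, gammaReal_ratCast, h]
  · obtain ⟨x, hx₀, hx⟩ := hbij.surjOn (Set.mem_Ici.2 (Rat.cast_nonneg.2 hq))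
    obtain ⟨μ, rfl⟩ := exists_ratCast_eq_of_gammaReal_eq_ratCast hx₀ hx
    exact ⟨μ, Rat.cast_nonneg.1 (Set.mem_Ici.1 hx₀),
      Rat.cast_injective (by rw [← gammaReal_ratCast, hx])⟩

end RationalValues

end ExceptionalSlopes

theorem mainTheorem4 :
    -- each rational number has exactly one associated exceptional slope, so `δ` is well defined
    (∀ μ : ℚ, ∃! α : ℚ, α ∈ ExceptionalSlopes.exceptionalSlopes ∧
      (μ : ℝ) ∈ ExceptionalSlopes.I α) ∧
    -- `γ` is a bijection from the nonnegative rationals to the nonnegative rationals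
    Set.BijOn ExceptionalSlopes.gamma {μ : ℚ | 0 ≤ μ} {q : ℚ | 0 ≤ q} ∧
    -- its extension to the nonnegative reals is continuous and bijective
    ContinuousOn ExceptionalSlopes.gammaReal (Set.Ici 0) ∧
    Set.BijOn ExceptionalSlopes.gammaReal (Set.Ici 0) (Set.Ici 0) ∧
    -- the preimage of a nonnegative rational never lies in the generalized Cantor set
    (∀ q : ℚ, 0 ≤ q → ∀ ξ : ℝ, 0 ≤ ξ → ExceptionalSlopes.gammaReal ξ = (q : ℝ) →
      ξ ∉ ExceptionalSlopes.cantorSet) := by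
  refine ⟨fun μ => ?_, ExceptionalSlopes.bijOn_gamma,
    ExceptionalSlopes.continuous_gammaReal.continuousOn, ExceptionalSlopes.bijOn_gammaReal,
    fun q _ ξ hξ₀ hq hξ =>
      ExceptionalSlopes.irrational_gammaReal_of_mem_cantorSet hξ hξ₀ ⟨q, hq.symm⟩⟩
  obtain ⟨α, hα, hμα⟩ := ExceptionalSlopes.exists_mem_I_ratCast μ
  exact ⟨α, ⟨hα, hμα⟩, fun β hβ =>
    ExceptionalSlopes.pairwiseDisjoint_I.elim_set hβ.1 hα μ hβ.2 hμα⟩
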